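/- For an integer $n\ge 0$ and real $\varepsilon$, let $\mathcal C(n,\varepsilon)$ be the set of binary words of length $n$ whose Hamming weight lies in $[\frac n2-\varepsilon,\frac n2+\varepsilon]$, and let $F(n,\alpha)=|\mathcal C(n,\alpha\sqrt n)|/2^n$. For $n\ge 1$, a single-redundancy-bit construction for a set $S\subseteq\{0,1\}^n$ is an encoder $E:\{0,1\}^{n-1}\to S$ together with a decoder $D$ such that $D(E(x))=x$ for all $x\in\{0,1\}^{n-1}$. There is a constant $c$ with $0.335<c\le 0.34$ such that: (a) for every $\alpha>c$ and all sufficiently large $n$ (depending on $\alpha$), $F(n,\alpha)\ge\frac12$ and there exists a single-redundancy-bit construction for $\mathcal C(n,\alpha\sqrt n)$; (b) for every $\alpha<c$ and all sufficiently large $n$ (depending on $\alpha$), $F(n,\alpha)<\frac12$ and there is no single-redundancy-bit construction for $\mathcal C(n,\alpha\sqrt n)$. Moreover, the order $\sqrt n$ is necessary and attained: if $\varepsilon:\mathbb N\to\mathbb R$ is such that a single-redundancy-bit construction for $\mathcal C(n,\varepsilon(n))$ exists for all sufficiently large $n$, then $\varepsilon(n)=\Omega(\sqrt n)$; and there is such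 a function with $\varepsilon(n)=\Theta(\sqrt n)$. -/

import Mathlib

open Filter Asymptotics

/-- The constraint `𝒞(n, ε)`: binary words of length `n` whose Hamming weight lies in the real
interval `[n/2 - ε, n/2 + ε]`. -/
def almostBalanced (n : ℕ) (ε : ℝ) : Set (Fin n → Fin 2) :=
  {x | (hammingNorm x : ℝ) ∈ Set.Icc ((n : ℝ) / 2 - ε) ((n : ℝ) / 2 + ε)}

/-- The fraction `F(n, α) = |𝒞(n, α√n)| / 2^n`. -/
noncomputable def balancedFraction (n : ℕ) (α : ℝ) : ℝ :=
  ((almostBalanced n (α * √(n : ℝ))).ncard : ℝ) / 2 ^ n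

/-- A construction with a single redundancy bit for a constraint `S` on binary words of length
`n ≥ 1`: an encoder taking each message of `n - 1` bits to a word of `S`, with a decoder that
recovers the message. -/
structure SingleBitConstruction (n : ℕ) (S : Set (Fin n → Fin 2)) where
  one_le : 1 ≤ n
  encode : (Fin (n - 1) → Fin 2) → (Fin n → Fin 2)
  decode : (Fin n → Fin 2) → (Fin (n - 1) → Fin 2)
  encode_mem : ∀ x, encode x ∈ S
  decode_encode : ∀ x, decode (encode x) = x

open MeasureTheory ProbabilityTheory

section Counting

/-! Pigeonhole reduces the coding question to counting: a construction exists exactly when the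
constraint holds at least half of all words (`nonempty_singleBitConstruction_iff`). For a uniform
random word, the central limit theorem applied to the bits as signs gives, for `α ≥ 0`, `F(n, α) →
P(|Z| ≤ 2α)` with `Z` standard Gaussian (`tendsto_balancedFraction`). This limit is continuous and
strictly increasing in `α`, so the threshold `c` is where it equals `1/2`; elementary bounds on
`exp` locate it. Any fixed `α` on either side of `c` then settles the order `√n`. -/

lemma almostBalanced_mono (n : ℕ) {ε δ : ℝ} (h : ε ≤ δ) :
    almostBalanced n ε ⊆ almostBalanced n δ :=
  fun _ hx ↦ Set.Icc_subset_Icc (by linarith) (by linarith) hx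

lemma almostBalanced_eq_empty (n : ℕ) {ε : ℝ} (h : ε < 0) : almostBalanced n ε = ∅ := by
  ext x
  simp only [almostBalanced, Set.mem_ofPred_eq, Set.mem_Icc, Set.mem_empty_iff_false, iff_false]
  rintro ⟨h1, h2⟩
  linarith

lemma nonempty_singleBitConstruction_iff {n : ℕ} (hn : 1 ≤ n) (S : Set (Fin n → Fin 2)) :
    Nonempty (SingleBitConstruction n S) ↔ 1 / 2 ≤ (S.ncard : ℝ) / 2 ^ n := by
  obtain ⟨m, rfl⟩ : ∃ m, n = m + 1 := ⟨n - 1, by omega⟩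
  have hcard : Nat.card (Fin m → Fin 2) = 2 ^ m := by simp
  have hcount : (1 / 2 : ℝ) ≤ (S.ncard : ℝ) / 2 ^ (m + 1) ↔ 2 ^ m ≤ S.ncard := by
    rw [le_div_iff₀ (by positivity), pow_succ, ← Nat.cast_le (α := ℝ)]
    push_cast
    constructor <;> intro h <;> linarith
  rw [hcount]
  constructor
  · rintro ⟨c⟩
    have hinj : Function.Injective (fun x ↦ (⟨c.encode x, c.encode_mem x⟩ : S)) := by
      intro x y hxy
      have h : c.encode x = c.encode y := Subtype.ext_iff.mp hxy
      rw [← c.decode_encode x, ← c.decode_encode y, h]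
    have := Nat.card_le_card_of_injective _ hinj
    rw [Nat.card_coe_set_eq] at this
    rw [← hcard]
    exact this
  · intro h
    have hle : Fintype.card (Fin m → Fin 2) ≤ Nat.card S := by
      rw [Nat.card_coe_set_eq, ← Nat.card_eq_fintype_card, hcard]
      exact h
    classical
    rw [Nat.card_eq_fintype_card] at hle
    obtain ⟨e⟩ := Function.Embedding.nonempty_of_card_le hle
    have hinj : Function.Injective (fun x ↦ (e x : Fin (m + 1) → Fin 2)) :=
      Subtype.val_injective.comp e.injective
    exact ⟨{ one_le := hn
             encode := fun x ↦ e x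
             decode := Function.invFun (fun x ↦ (e x : Fin (m + 1) → Fin 2))
             encode_mem := fun x ↦ (e x).2
             decode_encode := Function.leftInverse_invFun hinj }⟩

end Counting

section Gaussian

/-- The probability that a standard Gaussian variable lies in `[-t, t]`, for `t ≥ 0`. -/
noncomputable def gaussianCentral (t : ℝ) : ℝ := ∫ x in (-t)..t, gaussianPDFReal 0 1 x

lemma gaussianPDFReal_zero_one (x : ℝ) :
    gaussianPDFReal 0 1 x = (√(2 * Real.pi))⁻¹ * Real.exp (-x ^ 2 / 2) := by
  simp [gaussianPDFReal]

lemma gaussianCentral_eq (t : ℝ) :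
    gaussianCentral t = 2 * (√(2 * Real.pi))⁻¹ * ∫ x in 0..t, Real.exp (-x ^ 2 / 2) := by
  have hc : Continuous fun x : ℝ ↦ Real.exp (-x ^ 2 / 2) := by fun_prop
  have hs : ∫ x in (-t)..0, Real.exp (-x ^ 2 / 2) = ∫ x in 0..t, Real.exp (-x ^ 2 / 2) := by
    have := intervalIntegral.integral_comp_neg (a := 0) (b := t)
      (fun x : ℝ ↦ Real.exp (-x ^ 2 / 2))
    simpa using this.symm
  simp only [gaussianCentral, gaussianPDFReal_zero_one, intervalIntegral.integral_const_mul]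
  rw [← intervalIntegral.integral_add_adjacent_intervals (b := 0) (hc.intervalIntegrable _ _)
    (hc.intervalIntegrable _ _), hs]
  ring

lemma gaussianReal_Icc {t : ℝ} (ht : 0 ≤ t) :
    (gaussianReal 0 1 (Set.Icc (-t) t)).toReal = gaussianCentral t := by
  rw [gaussianReal_apply_eq_integral 0 one_ne_zero, ENNReal.toReal_ofReal
    (setIntegral_nonneg measurableSet_Icc fun _ _ ↦ gaussianPDFReal_nonneg _ _ _),
    gaussianCentral, intervalIntegral.integral_of_le (by linarith), integral_Icc_eq_integral_Ioc]

lemma strictMono_gaussianCentral : StrictMono gaussianCentral := by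
  intro s t hst
  have hc : Continuous fun x : ℝ ↦ Real.exp (-x ^ 2 / 2) := by fun_prop
  have hpos : 0 < ∫ x in s..t, Real.exp (-x ^ 2 / 2) :=
    intervalIntegral.intervalIntegral_pos_of_pos (hc.intervalIntegrable _ _)
      (fun x ↦ Real.exp_pos _) hst
  rw [gaussianCentral_eq, gaussianCentral_eq,
    ← intervalIntegral.integral_add_adjacent_intervals (a := 0) (b := s) (c := t)
      (hc.intervalIntegrable _ _) (hc.intervalIntegrable _ _)]
  have : 0 < (√(2 * Real.pi))⁻¹ := by positivity
  gcongr
  linarith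

lemma continuous_gaussianCentral : Continuous gaussianCentral := by
  have hc : Continuous fun x : ℝ ↦ Real.exp (-x ^ 2 / 2) := by fun_prop
  have : gaussianCentral = fun t ↦
      2 * (√(2 * Real.pi))⁻¹ * ∫ x in 0..t, Real.exp (-x ^ 2 / 2) := funext gaussianCentral_eq
  rw [this]
  exact continuous_const.mul
    (intervalIntegral.continuous_primitive (fun _ _ ↦ hc.intervalIntegrable _ _) 0)

lemma gaussianCentral_lt_half : gaussianCentral 0.67 < 1 / 2 := by
  have hc : Continuous fun x : ℝ ↦ Real.exp (-x ^ 2 / 2) := by fun_prop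
  have hbound (y : ℝ) (hy : 0 ≤ y) : Real.exp (-y) ≤ 1 - y + y ^ 2 / 2 := by
    have h := Real.quadratic_le_exp_of_nonneg hy
    rw [Real.exp_neg, inv_le_iff_one_le_mul₀ (Real.exp_pos y)]
    -- `(1 + y + y²/2)(1 - y + y²/2) = 1 + y⁴/4 ≥ 1`, and the second factor is `((y - 1)² + 1)/2 >
    -- 0`.
    nlinarith [sq_nonneg (y - 1), sq_nonneg (y ^ 2)]
  have hint : ∫ x in (0 : ℝ)..0.67, Real.exp (-x ^ 2 / 2) ≤
      ∫ x in (0 : ℝ)..0.67, (1 - x ^ 2 / 2 + x ^ 4 / 8) := by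
    refine intervalIntegral.integral_mono_on (by norm_num) (hc.intervalIntegrable _ _)
      ((by fun_prop : Continuous fun x : ℝ ↦ 1 - x ^ 2 / 2 + x ^ 4 / 8).intervalIntegrable _ _)
      fun x _ ↦ ?_
    have := hbound (x ^ 2 / 2) (by positivity)
    rw [neg_div]
    linarith [this, (by ring : (x ^ 2 / 2) ^ 2 / 2 = x ^ 4 / 8)]
  have hval : ∫ x in (0 : ℝ)..0.67, (1 - x ^ 2 / 2 + x ^ 4 / 8) =
      0.67 - 0.67 ^ 3 / 6 + 0.67 ^ 5 / 40 := by
    rw [intervalIntegral.integral_add (Continuous.intervalIntegrable (by fun_prop) _ _)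
      (Continuous.intervalIntegrable (by fun_prop) _ _),
      intervalIntegral.integral_sub (Continuous.intervalIntegrable (by fun_prop) _ _)
      (Continuous.intervalIntegrable (by fun_prop) _ _)]
    simp only [intervalIntegral.integral_div, integral_pow, intervalIntegral.integral_const]
    norm_num
  have hpi : (2.5 : ℝ) < √(2 * Real.pi) := by
    apply Real.lt_sqrt_of_sq_lt
    linarith [Real.pi_gt_d2]
  rw [gaussianCentral_eq, mul_assoc, inv_mul_eq_div, ← mul_div_assoc,
    div_lt_iff₀ (by positivity)]
  norm_num at hval hint hpi ⊢
  linarith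

/-- The tangent bound `1 - x²/2` suffices, but narrowly: the integral need only exceed `2.51/4 =
0.6275`, and the bound gives about `0.62759`. -/
lemma half_lt_gaussianCentral : 1 / 2 < gaussianCentral 0.68 := by
  have hc : Continuous fun x : ℝ ↦ Real.exp (-x ^ 2 / 2) := by fun_prop
  have hint : ∫ x in (0 : ℝ)..0.68, (1 - x ^ 2 / 2) ≤
      ∫ x in (0 : ℝ)..0.68, Real.exp (-x ^ 2 / 2) := by
    refine intervalIntegral.integral_mono_on (by norm_num)
      ((by fun_prop : Continuous fun x : ℝ ↦ 1 - x ^ 2 / 2).intervalIntegrable _ _)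
      (hc.intervalIntegrable _ _) fun x _ ↦ ?_
    linarith [Real.add_one_le_exp (-x ^ 2 / 2)]
  have hval : ∫ x in (0 : ℝ)..0.68, (1 - x ^ 2 / 2) = 0.68 - 0.68 ^ 3 / 6 := by
    rw [intervalIntegral.integral_sub (Continuous.intervalIntegrable (by fun_prop) _ _)
      (Continuous.intervalIntegrable (by fun_prop) _ _)]
    simp only [intervalIntegral.integral_div, integral_pow, intervalIntegral.integral_const]
    norm_num
  have hpi : √(2 * Real.pi) < 2.51 := by
    rw [Real.sqrt_lt' (by norm_num)]
    linarith [Real.pi_lt_d4]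
  rw [gaussianCentral_eq, mul_assoc, inv_mul_eq_div, ← mul_div_assoc,
    lt_div_iff₀ (by positivity)]
  norm_num at hval hint hpi ⊢
  linarith

/-- The limiting threshold: half of the upper quartile of the standard Gaussian distribution. -/
lemma exists_gaussianCentral_eq_half :
    ∃ c : ℝ, 0.335 < c ∧ c ≤ 0.34 ∧ gaussianCentral (2 * c) = 1 / 2 := by
  obtain ⟨t, ⟨h1, h2⟩, ht⟩ := intermediate_value_Ioo (by norm_num : (0.67 : ℝ) ≤ 0.68)
    continuous_gaussianCentral.continuousOn ⟨gaussianCentral_lt_half, half_lt_gaussianCentral⟩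
  refine ⟨t / 2, by norm_num at h1 ⊢; linarith, by norm_num at h2 ⊢; linarith, ?_⟩
  rw [mul_div_cancel₀ t two_ne_zero, ht]

end Gaussian

section Limit

/-- The sign `±1` attached to a bit. -/
noncomputable def bitSign (b : Fin 2) : ℝ := if b ≠ 0 then 1 else -1

lemma sum_bitSign {n : ℕ} (x : Fin n → Fin 2) :
    ∑ i, bitSign (x i) = 2 * (hammingNorm x : ℝ) - n := by
  have h (i : Fin n) : bitSign (x i) = 2 * (if x i ≠ 0 then (1 : ℝ) else 0) - 1 := by
    unfold bitSign
    split_ifs <;> norm_num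
  simp only [h, Finset.sum_sub_distrib, ← Finset.mul_sum, Finset.sum_boole, hammingNorm]
  simp

/-- The sign sum is twice the deviation of the weight from `n/2`, hence `2α`. -/
lemma mem_almostBalanced_iff {n : ℕ} (hn : 1 ≤ n) (α : ℝ) (x : Fin n → Fin 2) :
    x ∈ almostBalanced n (α * √(n : ℝ)) ↔
      (√(n : ℝ))⁻¹ * ∑ i, bitSign (x i) ∈ Set.Icc (-(2 * α)) (2 * α) := by
  have hs : 0 < √(n : ℝ) := Real.sqrt_pos.mpr (by exact_mod_cast hn)
  rw [sum_bitSign, inv_mul_eq_div, Set.mem_Icc, le_div_iff₀ hs, div_le_iff₀ hs, almostBalanced,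
    Set.mem_ofPred_eq, Set.mem_Icc]
  constructor <;> rintro ⟨h1, h2⟩ <;> constructor <;> linarith

/-- Independent fair bits give the uniform distribution on words. -/
lemma measure_word_mem {Ω : Type*} [MeasurableSpace Ω] {P : Measure Ω} [IsProbabilityMeasure P]
    {B : ℕ → Ω → Fin 2} (hB : ∀ i, Measurable (B i))
    (hlaw : ∀ i, HasLaw (B i) (uniformOn Set.univ) P) (hind : iIndepFun B P)
    {n : ℕ} (S : Set (Fin n → Fin 2)) :
    P {ω | (fun i : Fin n ↦ B i ω) ∈ S} = (S.ncard : ENNReal) / 2 ^ n := by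
  have hmap : P.map (fun ω (i : Fin n) ↦ B i ω) = uniformOn Set.univ := by
    have h := (iIndepFun_iff_map_fun_eq_pi_map fun i : Fin n ↦ (hB i).aemeasurable).mp
      (hind.precomp Fin.val_injective)
    rw [h]
    simp only [(hlaw _).map_eq]
    have hp := uniformOn_pi (ι := Fin n) (Ω := Fin 2) (f := fun _ ↦ Set.univ)
    rw [Set.pi_univ] at hp
    exact hp.symm
  have hm : Measurable (fun ω (i : Fin n) ↦ B i ω) := measurable_pi_lambda _ fun i ↦ hB i
  change P ((fun ω (i : Fin n) ↦ B i ω) ⁻¹' S) = _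
  rw [← Measure.map_apply hm S.toFinite.measurableSet, hmap, uniformOn_univ,
    Measure.count_apply_finite _ S.toFinite, Set.ncard_eq_toFinset_card S]
  simp

lemma tendsto_balancedFraction {α : ℝ} (hα : 0 ≤ α) :
    Tendsto (fun n ↦ balancedFraction n α) atTop (nhds (gaussianCentral (2 * α))) := by
  have : IsProbabilityMeasure (uniformOn (Set.univ : Set (Fin 2))) :=
    isProbabilityMeasure_uniformOn Set.finite_univ Set.univ_nonempty
  obtain ⟨Ω, _, P, B, hB, hlaw, hind, _⟩ := exists_iid ℕ (uniformOn (Set.univ : Set (Fin 2)))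
  have hmeas : Measurable bitSign := measurable_of_finite _
  have hint (f : Fin 2 → ℝ) : ∫ ω, f (B 0 ω) ∂P = (f 0 + f 1) / 2 := by
    rw [← integral_map (hB 0).aemeasurable (measurable_of_finite f).aestronglyMeasurable,
      (hlaw 0).map_eq, integral_fintype (Integrable.of_finite)]
    have hreal (b : Fin 2) : (uniformOn (Set.univ : Set (Fin 2))).real {b} = 1 / 2 := by
      simp [Measure.real, uniformOn_univ]
    simp [hreal]
    ring
  have hclt := tendstoInDistribution_inv_sqrt_mul_sum (P := P) (X := fun i ω ↦ bitSign (B i ω))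
    (Y := id) (P' := gaussianReal 0 1) HasLaw.id
    (by rw [hint]; norm_num [bitSign])
    ((hint fun b ↦ bitSign b ^ 2).trans (by norm_num [bitSign]))
    (hind.comp (fun _ ↦ bitSign) fun _ ↦ hmeas)
    (fun i ↦ (IdentDistrib.mk (hB i).aemeasurable (hB 0).aemeasurable
      ((hlaw i).map_eq.trans (hlaw 0).map_eq.symm)).comp hmeas)
  have := nullSingletonClass_gaussianReal (μ := 0) (one_ne_zero : (1 : NNReal) ≠ 0)
  -- Convergence in distribution gives convergence on sets with null boundary; here the boundary is
  -- finite and the Gaussian has no atoms.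
  have hfr : gaussianReal 0 1 (frontier (Set.Icc (-(2 * α)) (2 * α))) = 0 := by
    rw [frontier_Icc (by linarith)]
    exact (Set.toFinite _).measure_zero _
  have hlim := ProbabilityMeasure.tendsto_measure_of_null_frontier_of_tendsto' hclt.tendsto
    (E := Set.Icc (-(2 * α)) (2 * α)) (by simpa using hfr)
  simp only [ProbabilityMeasure.coe_mk, Measure.map_id] at hlim
  have hreal := (ENNReal.tendsto_toReal (measure_ne_top _ _)).comp hlim
  rw [gaussianReal_Icc (by linarith)] at hreal
  refine hreal.congr' ?_
  filter_upwards [eventually_ge_atTop 1] with n hn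
  have hset : (fun ω ↦ (√(n : ℝ))⁻¹ * ∑ k ∈ Finset.range n, bitSign (B k ω)) ⁻¹'
      Set.Icc (-(2 * α)) (2 * α) =
      {ω | (fun i : Fin n ↦ B i ω) ∈ almostBalanced n (α * √(n : ℝ))} := by
    ext ω
    rw [Set.mem_ofPred_eq, mem_almostBalanced_iff hn,
      Fin.sum_univ_eq_sum_range fun k ↦ bitSign (B k ω)]
    rfl
  have hm : Measurable fun ω ↦ (√(n : ℝ))⁻¹ * ∑ k ∈ Finset.range n, bitSign (B k ω) :=
    (Finset.measurable_fun_sum _ fun k _ ↦ hmeas.comp (hB k)).const_mul _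
  rw [Function.comp_apply, Measure.map_apply hm measurableSet_Icc, hset,
    measure_word_mem hB hlaw hind]
  simp [balancedFraction]

end Limit

lemma eventually_balancedFraction_lt_half {c α : ℝ}
    (hc : gaussianCentral (2 * c) = 1 / 2) (hα : α < c) :
    ∀ᶠ n : ℕ in atTop, balancedFraction n α < 1 / 2 := by
  -- For `α < 0` the limit lemma does not apply, but the constraint is empty.
  rcases lt_or_ge α 0 with h | h
  · filter_upwards [eventually_ge_atTop 1] with n hn
    have hs : 0 < √(n : ℝ) := Real.sqrt_pos.mpr (by exact_mod_cast hn)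
    rw [balancedFraction, almostBalanced_eq_empty n (mul_neg_of_neg_of_pos h hs)]
    norm_num
  · refine (tendsto_balancedFraction h).eventually_lt_const ?_
    rw [← hc]
    exact strictMono_gaussianCentral (by linarith)

lemma eventually_half_le_balancedFraction {c α : ℝ} (hc0 : 0 ≤ c)
    (hc : gaussianCentral (2 * c) = 1 / 2) (hα : c < α) :
    ∀ᶠ n : ℕ in atTop, 1 / 2 ≤ balancedFraction n α := by
  have h : 1 / 2 < gaussianCentral (2 * α) := by
    rw [← hc]
    exact strictMono_gaussianCentral (by linarith)
  exact ((tendsto_balancedFraction (hc0.trans hα.le)).eventually_const_lt h).mono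
    fun _ ↦ le_of_lt

theorem mainTheorem2 :
    ∃ c : ℝ, 0.335 < c ∧ c ≤ 0.34 ∧
      (∀ α : ℝ, c < α → ∀ᶠ n : ℕ in atTop,
        1 / 2 ≤ balancedFraction n α ∧
          Nonempty (SingleBitConstruction n (almostBalanced n (α * √(n : ℝ))))) ∧
      (∀ α : ℝ, α < c → ∀ᶠ n : ℕ in atTop,
        balancedFraction n α < 1 / 2 ∧
          IsEmpty (SingleBitConstruction n (almostBalanced n (α * √(n : ℝ))))) ∧
      (∀ ε : ℕ → ℝ,
        (∀ᶠ n : ℕ in atTop, Nonempty (SingleBitConstruction n (almostBalanced n (ε n)))) →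
          (fun n : ℕ => √(n : ℝ)) =O[atTop] ε) ∧
      (∃ ε : ℕ → ℝ, ε =Θ[atTop] (fun n : ℕ => √(n : ℝ)) ∧
        ∀ᶠ n : ℕ in atTop, Nonempty (SingleBitConstruction n (almostBalanced n (ε n)))) := by
  obtain ⟨c, hc1, hc2, hc⟩ := exists_gaussianCentral_eq_half
  have hc0 : 0 ≤ c := by norm_num at hc1; linarith
  have hlow (α : ℝ) (hα : α < c) : ∀ᶠ n : ℕ in atTop, balancedFraction n α < 1 / 2 ∧
      IsEmpty (SingleBitConstruction n (almostBalanced n (α * √(n : ℝ)))) := by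
    filter_upwards [eventually_balancedFraction_lt_half hc hα, eventually_ge_atTop 1]
      with n h hn
    refine ⟨h, not_nonempty_iff.mp fun hne ↦ ?_⟩
    exact h.not_ge ((nonempty_singleBitConstruction_iff hn _).mp hne)
  have hhigh (α : ℝ) (hα : c < α) : ∀ᶠ n : ℕ in atTop, 1 / 2 ≤ balancedFraction n α ∧
      Nonempty (SingleBitConstruction n (almostBalanced n (α * √(n : ℝ)))) := by
    filter_upwards [eventually_half_le_balancedFraction hc0 hc hα, eventually_ge_atTop 1]
      with n h hn
    exact ⟨h, (nonempty_singleBitConstruction_iff hn _).mpr h⟩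
  refine ⟨c, hc1, hc2, hhigh, hlow, fun ε hε ↦ ?_, fun n ↦ √(n : ℝ), isTheta_refl _ _, ?_⟩
  -- `4` is the inverse of `1/4`, a convenient positive value below `c`: by monotonicity, `ε n <
  -- √n/4` would contradict the lower regime.
  · refine IsBigO.of_bound 4 ?_
    filter_upwards [hε, hlow (1 / 4) (by norm_num at hc1; linarith)] with n ⟨C⟩ ⟨_, hn⟩
    have hle : 1 / 4 * √(n : ℝ) ≤ ε n := by
      by_contra! hlt
      exact hn.false ⟨C.one_le, C.encode, C.decode,
        fun x ↦ almostBalanced_mono n hlt.le (C.encode_mem x), C.decode_encode⟩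
    rw [Real.norm_of_nonneg (Real.sqrt_nonneg _)]
    linarith [Real.le_norm_self (ε n)]
  · filter_upwards [hhigh 1 (by norm_num at hc2; linarith)] with n h
    simpa only [one_mul] using h.2
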